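/- **Setting.** Let $f:\mathbb{R}^d\to\mathbb{R}$ be twice continuously differentiable, $g=\nabla f$, $H=\nabla^2 f$, let $\mathcal P$ be the projection onto the nonnegative orthant $\mathbb{R}^d_+$, and for $\delta\ge 0$ let $\mathcal A(x,\delta)=\{i: 0\le x^i\le\delta\}$, $\mathcal I(x,\delta)=\{i: x^i>\delta\}$. A superscript $\mathcal A$ or $\mathcal I$ denotes the subvector, and $H^{\mathcal I}$ the principal submatrix. A point $x$ is $\epsilon$-approximate first-order optimal ($\epsilon$-FO) if, with $\mathcal A=\mathcal A(x,\sqrt\epsilon)$ and $\mathcal I=\mathcal I(x,\sqrt\epsilon)$, $$g(x)^i\ge-\sqrt\epsilon\ (i\in\mathcal A),\qquad \|\mathrm{diag}(x^{\mathcal A})\,g(x)^{\mathcal A}\|\le\epsilon,\qquad \|g(x)^{\mathcal I}\|\le\epsilon .$$ **MINRES$(H,g,\eta,\bar\varsigma)$.** If $g=0$, return $0$ with label SOL. Otherwise let $s^{(t)}$ minimize $\|Hs+g\|$ over $\mathrm{span}\{g,Hg,\dots,H^{t-1}g\}$ (so $s^{(0)}=0$) and $r^{(t)}=-Hs^{(t)}-g$.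 For $t=1,2,\dots$: if $\langle r^{(t-1)},Hr^{(t-1)}\rangle\le\bar\varsigma\|r^{(t-1)}\|^2$, return $r^{(t-1)}$ with label NPC; otherwise form $s^{(t)}$ and, if $\|Hr^{(t)}\|\le\eta\|Hs^{(t)}\|$, return $s^{(t)}$ with label SOL. (Thus an NPC direction is returned only if the termination condition is not yet satisfied.) **Algorithm (Newton-MR two-metric projection).** Input: $x_0\ge 0$, tolerances $\delta_k,\epsilon_k$, $\eta>0$, $\bar\varsigma=(d+1)\varsigma$ with $\varsigma>0$, $\rho\in(0,1/2)$, $\zeta\in(0,1)$. For $k=0,1,\dots$, put $g_k=g(x_k)$, $\mathcal A=\mathcal A(x_k,\delta_k)$, $\mathcal I=\mathcal I(x_k,\delta_k)$. Terminate if $g_k^i\ge-\epsilon_k$ for $i\in\mathcal A$, $\|\mathrm{diag}(x_k^{\mathcal A})g_k^{\mathcal A}\|\le\epsilon_k^2$ and $\|g_k^{\mathcal I}\|\le\epsilon_k^2$. Otherwise let $p_k^{\mathcal A}=-g_k^{\mathcal A}$, let $p_k^{\mathcal I}$ be the output of MINRES$(H(x_k)^{\mathcal I},g_k^{\mathcal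 I},\eta,\bar\varsigma)$, and set $x_{k+1}=\mathcal P(x_k+\alpha_kp_k)$, where $\alpha_k$ is found by a line search starting from $\alpha=1$ with the criterion $$f(\mathcal P(x_k+\alpha p_k))-f(x_k)\le\rho\langle g_k^{\mathcal A},\mathcal P(x_k^{\mathcal A}+\alpha p_k^{\mathcal A})-x_k^{\mathcal A}\rangle+\alpha\rho\langle g_k^{\mathcal I},p_k^{\mathcal I}\rangle .$$ For label SOL, or if $\alpha=1$ fails the criterion, $\alpha$ is multiplied by $\zeta$ until the criterion holds. For label NPC, if $\alpha=1$ satisfies the criterion, $\alpha$ is divided by $\zeta$ until the criterion fails, and the last step size that satisfied it is used. **Theorem 1 (Global complexity).** For all $\rho\in(0,1/2)$, $\varsigma>0$, $\eta>0$, $\zeta\in(0,1)$ and $L_g\ge0$ there is a constant $C>0$, depending only on these five numbers, such that the following holds for every dimension $d$, every twice continuously differentiable $f:\mathbb{R}^d\to\mathbb{R}$, every $f_*\in\mathbb{R}$, every $x_0\in\mathbb{R}^d_+$ and every $\epsilon_g\in(0,1)$. Suppose that $\|\nabla f(x)-\nabla f(y)\|\le L_g\|x-y\|$ for all $x,y\in\mathbb{R}^d_+$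 and $f(x)\ge f_*$ for all $x\in\mathbb{R}^d_+$. Then the algorithm with $\delta_k=\epsilon_k=\epsilon_g^{1/2}$ and $\bar\varsigma=(d+1)\varsigma$ is well defined (MINRES and the line searches return at every iteration), and it terminates after at most $C\,(f(x_0)-f_*)\,\epsilon_g^{-2}$ iterations at a point of $\mathbb{R}^d_+$ that is $\epsilon_g$-FO. -/

import Mathlib

namespace NewtonMRTMP

noncomputable section

/-! ### MINRES with curvature monitoring -/

/-- The two kinds of direction that MINRES can return: an approximate solution of the Newton
system (`sol`), or a residual along which the curvature is not sufficiently positive (`npc`). -/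
inductive StepType
  | sol
  | npc

section Minres

variable {E : Type*} [NormedAddCommGroup E] [InnerProductSpace ℝ E]

/-- The Krylov subspace `K_t(H, g) = span {g, H g, …, H^(t-1) g}`. -/
def krylov (H : E →ₗ[ℝ] E) (g : E) (t : ℕ) : Submodule ℝ E :=
  Submodule.span ℝ ((fun j : ℕ => (H ^ j) g) '' Set.Iio t)

/-- `s` is a `t`-th MINRES iterate: a minimizer of `‖H s + g‖` over `K_t(H, g)`. -/
def IsMinresIterate (H : E →ₗ[ℝ] E) (g : E) (t : ℕ) (s : E) : Prop :=
  s ∈ krylov H g t ∧ ∀ s' ∈ krylov H g t, ‖H s + g‖ ≤ ‖H s' + g‖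

/-- The residual `r = - H s - g` of the Newton system at `s`. -/
def residual (H : E →ₗ[ℝ] E) (g s : E) : E := - H s - g

/-- The insufficient-curvature test `⟨r, H r⟩ ≤ θ ‖r‖²` with tolerance `θ`. -/
def CurvatureTest (H : E →ₗ[ℝ] E) (θ : ℝ) (r : E) : Prop :=
  inner ℝ r (H r) ≤ θ * ‖r‖ ^ 2

/-- The inexactness (termination) test `‖H r‖ ≤ η ‖H s‖`, with `r` the residual at `s`. -/
def InexactnessTest (H : E →ₗ[ℝ] E) (g : E) (η : ℝ) (s : E) : Prop :=
  ‖H (residual H g s)‖ ≤ η * ‖H s‖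

/-- `MinresReturns H g η θ p D`: MINRES applied to `H, g` with inexactness tolerance `η` and
curvature tolerance `θ` returns the direction `p`, with label `D`.

If `g = 0` the Newton system is solved by `0`, which is returned. Otherwise, for `t = 0, 1, 2, …`:
if the residual `r_t` of the iterate `s_t` passes the curvature test, then `r_t` is returned with
label `npc`; if not, the iterate `s_(t+1)` is formed, and if it passes the inexactness test, it is
returned with label `sol`. So a residual is returned only when the termination condition was
not yet satisfied. -/
def MinresReturns (H : E →ₗ[ℝ] E) (g : E) (η θ : ℝ) (p : E) (D : StepType) : Prop :=
  (g = 0 ∧ p = 0 ∧ D = StepType.sol) ∨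
  (g ≠ 0 ∧ ∃ s : ℕ → E, (∀ t, IsMinresIterate H g t (s t)) ∧
    ∃ t : ℕ,
      (∀ j < t, ¬ CurvatureTest H θ (residual H g (s j)) ∧ ¬ InexactnessTest H g η (s (j + 1))) ∧
      ((CurvatureTest H θ (residual H g (s t)) ∧
          p = residual H g (s t) ∧ D = StepType.npc) ∨
        (¬ CurvatureTest H θ (residual H g (s t)) ∧ InexactnessTest H g η (s (t + 1)) ∧
          p = s (t + 1) ∧ D = StepType.sol)))

end Minres

/-! ### Line searches -/

/-- Backward tracking from `α₀` with factor `ζ` returns `α`: the first of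
`α₀, ζ α₀, ζ² α₀, …` that satisfies the criterion. -/
def BacktrackReturns (crit : ℝ → Prop) (ζ α₀ α : ℝ) : Prop :=
  ∃ m : ℕ, α = ζ ^ m * α₀ ∧ crit (ζ ^ m * α₀) ∧ ∀ j < m, ¬ crit (ζ ^ j * α₀)

/-- Forward/backward tracking from `α₀` with factor `ζ` returns `α`: if `α₀` fails the criterion,
track backward; otherwise replace `α` by `α / ζ` as long as the criterion holds, and
return `ζ` times the first trial step that fails. -/
def ForwardTrackReturns (crit : ℝ → Prop) (ζ α₀ α : ℝ) : Prop :=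
  (¬ crit α₀ ∧ BacktrackReturns crit ζ α₀ α) ∨
  (crit α₀ ∧ ∃ m : ℕ, α = ζ * (α₀ / ζ ^ m) ∧ ¬ crit (α₀ / ζ ^ m) ∧ ∀ j < m, crit (α₀ / ζ ^ j))

/-! ### The two-metric projection method on the nonnegative orthant -/

variable {d : ℕ}

/-- The nonnegative orthant of `ℝ^d`. -/
def orthant (d : ℕ) : Set (EuclideanSpace ℝ (Fin d)) := {x | ∀ i, 0 ≤ x i}

/-- The orthogonal projection onto the nonnegative orthant. -/
def proj (x : EuclideanSpace ℝ (Fin d)) : EuclideanSpace ℝ (Fin d) :=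
  WithLp.toLp 2 fun i => max (x i) 0

/-- The `δ`-active set `{i | 0 ≤ x_i ≤ δ}`. -/
def activeSet (x : EuclideanSpace ℝ (Fin d)) (δ : ℝ) : Finset (Fin d) :=
  Finset.univ.filter fun i => 0 ≤ x i ∧ x i ≤ δ

/-- The `δ`-inactive set `{i | δ < x_i}`. -/
def inactiveSet (x : EuclideanSpace ℝ (Fin d)) (δ : ℝ) : Finset (Fin d) :=
  Finset.univ.filter fun i => δ < x i

/-- The subvector `v^S` of the components of `v` with index in `S`. -/
def subvec (S : Finset (Fin d)) (v : EuclideanSpace ℝ (Fin d)) : EuclideanSpace ℝ S :=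
  WithLp.toLp 2 fun i => v i

/-- The Hessian matrix of `f` at `x`, as the derivative of the gradient. -/
def hessian (f : EuclideanSpace ℝ (Fin d) → ℝ) (x : EuclideanSpace ℝ (Fin d)) :
    Matrix (Fin d) (Fin d) ℝ :=
  Matrix.of fun i j => fderiv ℝ (gradient f) x (EuclideanSpace.single j 1) i

/-- The principal submatrix of the Hessian with indices in `S`, acting on `ℝ^S`. -/
def subHessian (f : EuclideanSpace ℝ (Fin d) → ℝ) (x : EuclideanSpace ℝ (Fin d))
    (S : Finset (Fin d)) : EuclideanSpace ℝ S →ₗ[ℝ] EuclideanSpace ℝ S :=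
  Matrix.toEuclideanLin ((hessian f x).submatrix (fun i : S => (i : Fin d)) fun i : S => (i : Fin d))

/-- `x` is an `ε`-approximate first-order optimal point for minimizing `f` over the nonnegative
orthant (with `A`, `I` the `√ε`-active and `√ε`-inactive sets of `x`): `∇f(x)_i ≥ -√ε` on `A`,
`‖diag(x^A) ∇f(x)^A‖ ≤ ε` and `‖∇f(x)^I‖ ≤ ε`. -/
def IsFO (f : EuclideanSpace ℝ (Fin d) → ℝ) (ε : ℝ) (x : EuclideanSpace ℝ (Fin d)) : Prop :=
  (∀ i ∈ activeSet x (√ε), -√ε ≤ gradient f x i) ∧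
  ‖subvec (activeSet x (√ε)) (WithLp.toLp 2 fun i => x i * gradient f x i)‖ ≤ ε ∧
  ‖subvec (inactiveSet x (√ε)) (gradient f x)‖ ≤ ε

/-- The input of the algorithm besides the objective and the initial point: active set tolerances
`δ`, optimality tolerances `ε`, MINRES inexactness tolerance `η`, MINRES curvature tolerance `θ`,
line search parameter `ρ` and line search scaling factor `ζ`. -/
structure Params where
  δ : ℕ → ℝ
  ε : ℕ → ℝ
  η : ℝ
  θ : ℝ
  ρ : ℝ
  ζ : ℝ

/-- The termination test of iteration `k` of the algorithm at the point `x`. -/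
def Terminates (f : EuclideanSpace ℝ (Fin d) → ℝ) (P : Params) (k : ℕ)
    (x : EuclideanSpace ℝ (Fin d)) : Prop :=
  (∀ i ∈ activeSet x (P.δ k), -P.ε k ≤ gradient f x i) ∧
  ‖subvec (activeSet x (P.δ k)) (WithLp.toLp 2 fun i => x i * gradient f x i)‖ ≤ P.ε k ^ 2 ∧
  ‖subvec (inactiveSet x (P.δ k)) (gradient f x)‖ ≤ P.ε k ^ 2

/-- The line search criterion at `x` for the direction `p` and the step size `α`:
`f(P(x + α p)) - f(x) ≤ ρ ⟨g^A, P(x^A + α p^A) - x^A⟩ + α ρ ⟨g^I, p^I⟩`. -/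
def LineSearchCriterion (f : EuclideanSpace ℝ (Fin d) → ℝ) (δ ρ : ℝ)
    (x p : EuclideanSpace ℝ (Fin d)) (α : ℝ) : Prop :=
  f (proj (x + α • p)) - f x ≤
    ρ * ∑ i ∈ activeSet x δ, gradient f x i * (proj (x + α • p) i - x i) +
      α * ρ * ∑ i ∈ inactiveSet x δ, gradient f x i * p i

/-- `Step f P k x y`: iteration `k` of the algorithm, started at `x`, does not terminate
and moves to `y`. On the active set the direction is the negative gradient, on the inactive set it
is the direction returned by MINRES; the step size comes from backward tracking for `sol`
directions, and from forward/backward tracking for `npc` directions, starting from `1`. -/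
def Step (f : EuclideanSpace ℝ (Fin d) → ℝ) (P : Params) (k : ℕ)
    (x y : EuclideanSpace ℝ (Fin d)) : Prop :=
  ¬ Terminates f P k x ∧
  ∃ (p : EuclideanSpace ℝ (Fin d)) (D : StepType) (α : ℝ),
    (∀ i ∈ activeSet x (P.δ k), p i = -gradient f x i) ∧
    MinresReturns (subHessian f x (inactiveSet x (P.δ k)))
      (subvec (inactiveSet x (P.δ k)) (gradient f x)) P.η P.θ
      (subvec (inactiveSet x (P.δ k)) p) D ∧
    (match D with
      | StepType.sol => BacktrackReturns (LineSearchCriterion f (P.δ k) P.ρ x p) P.ζ 1 α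
      | StepType.npc => ForwardTrackReturns (LineSearchCriterion f (P.δ k) P.ρ x p) P.ζ 1 α) ∧
    y = proj (x + α • p)

/-- `IsRun f P x₀ x N`: the points `x 0 = x₀, x 1, …, x N` are the first iterates of the algorithm
started at `x₀`, that is, the algorithm performs `N` iterations without terminating and is
then at `x N`. -/
def IsRun (f : EuclideanSpace ℝ (Fin d) → ℝ) (P : Params) (x₀ : EuclideanSpace ℝ (Fin d))
    (x : ℕ → EuclideanSpace ℝ (Fin d)) (N : ℕ) : Prop :=
  x 0 = x₀ ∧ ∀ k < N, Step f P k (x k) (x (k + 1))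

end

end NewtonMRTMP

/-!
Every iteration decreases `f` by at least a fixed multiple of `ε²`, and `f` is bounded below, so
the number of iterations is `O(ε⁻²)`. The only delicate point is that the multiple must not depend
on the dimension.

**MINRES.** The residual `r_t` is orthogonal to `H K_t`. Hence the residuals are `H`-conjugate,
`⟨g, r_t⟩ = -‖r_t‖²`, and `⟨r_t, r_i⟩ = ‖r_t‖²` for `i ≤ t`. As long as the curvature test fails,
the residuals are linearly independent, so that MINRES returns after at most `dim E + 1` tests
(`exists_minresReturns`), and they form a basis of the Krylov space. In this basis `s_t` has the
nonnegative coordinates `(‖r_i‖² - ‖r_t‖²) / ⟨r_i, H r_i⟩`, which gives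
`⟨g, s_t⟩ ≤ -⟨s_t, H s_t⟩` (`inner_iterate_le`). The curvature of `s_t` may be `t ≤ d` times smaller
than that of the residuals; the factor `d + 1` in the curvature tolerance makes up for it. So the
returned direction `p` satisfies `⟨g, p⟩ ≤ -min(1, ς) ‖p‖²`, and by the termination tests
`‖g‖ ≤ κ ‖p‖` with `κ` depending on `L, η, ς` only (`MinresReturns.direction`). The bound
`‖H‖ ≤ L` on the inactive block comes from the Lipschitz gradient (`norm_subHessian_le`).

**Line search.** By the descent lemma the criterion holds when `α (L + 1) ≤ min(1, ς)` and
`α ‖p^I‖ ≤ √ε`, the second condition keeping the inactive components positive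
(`lineSearchCriterion_of_small`). An accepted step therefore has either `α` bounded below or
`α ‖p^I‖ ≥ ζ √ε`. In the second case the inactive part of the criterion gives a decrease of order
`ε`, unless `α` is bounded below anyway. In the first case the violated part of the termination
test gives a decrease of order `ε²` (`decrease_of_lineSearchCriterion`). Forward tracking stops
because `f` is bounded below.
-/

namespace NewtonMRTMP

/-! ### Krylov subspaces and MINRES residuals -/

section Minres

variable {E : Type*} [NormedAddCommGroup E] [InnerProductSpace ℝ E]
  {H : E →ₗ[ℝ] E} {g : E} {s : ℕ → E} {t : ℕ}

lemma krylov_mono (H : E →ₗ[ℝ] E) (g : E) : Monotone (krylov H g) := fun _ _ h =>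
  Submodule.span_mono (Set.image_mono (Set.Iio_subset_Iio h))

lemma krylov_zero (H : E →ₗ[ℝ] E) (g : E) : krylov H g 0 = ⊥ := by
  simp [krylov]

lemma mem_krylov_succ (H : E →ₗ[ℝ] E) (g : E) (t : ℕ) : g ∈ krylov H g (t + 1) :=
  Submodule.subset_span ⟨0, by simp, by simp⟩

lemma map_mem_krylov_succ {v : E} (hv : v ∈ krylov H g t) : H v ∈ krylov H g (t + 1) := by
  refine (Submodule.span_le (p := (krylov H g (t + 1)).comap H)).2 ?_ hv
  rintro _ ⟨j, hj, rfl⟩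
  exact Submodule.subset_span ⟨j + 1, by simpa using hj, by simp [pow_succ']⟩

instance finiteDimensional_krylov (H : E →ₗ[ℝ] E) (g : E) (t : ℕ) :
    FiniteDimensional ℝ (krylov H g t) :=
  FiniteDimensional.span_of_finite ℝ ((Set.finite_Iio t).image _)

lemma finrank_krylov_le (H : E →ₗ[ℝ] E) (g : E) (t : ℕ) :
    Module.finrank ℝ (krylov H g t) ≤ t := by
  classical
  have h := finrank_span_finset_le_card (R := ℝ)
    ((Finset.range t).image fun j : ℕ => (H ^ j) g)
  have h' : (((Finset.range t).image fun j : ℕ => (H ^ j) g : Finset E) : Set E) =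
      (fun j : ℕ => (H ^ j) g) '' Set.Iio t := by
    ext; simp
  rw [Set.finrank, h'] at h
  exact h.trans (Finset.card_image_le.trans (by simp))

lemma residual_mem_krylov_succ {v : E} (hv : v ∈ krylov H g t) :
    residual H g v ∈ krylov H g (t + 1) :=
  sub_mem (neg_mem (map_mem_krylov_succ hv)) (mem_krylov_succ H g t)

lemma norm_residual (H : E →ₗ[ℝ] E) (g v : E) : ‖residual H g v‖ = ‖H v + g‖ := by
  rw [← norm_neg, residual]; congr 1; abel

lemma exists_isMinresIterate (H : E →ₗ[ℝ] E) (g : E) (t : ℕ) : ∃ v, IsMinresIterate H g t v := by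
  obtain ⟨w, hw, hmin⟩ := ((krylov H g t).map H).exists_norm_eq_iInf_of_complete_subspace
    (Submodule.complete_of_finiteDimensional _) (-g)
  obtain ⟨v, hv, rfl⟩ := hw
  refine ⟨v, hv, fun v' hv' => ?_⟩
  have h := ciInf_le (f := fun w : (krylov H g t).map H => ‖-g - w‖)
    ⟨0, by rintro _ ⟨_, rfl⟩; exact norm_nonneg _⟩ ⟨H v', Submodule.mem_map_of_mem hv'⟩
  have h' := hmin.trans_le h
  rwa [← neg_add', norm_neg, ← neg_add', norm_neg, add_comm, add_comm g] at h'

/-- The normal equations of the MINRES least-squares problem: the residual of a `t`-th iterate is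
orthogonal to `H K_t`. -/
lemma IsMinresIterate.inner_residual_map {u v : E} (hu : IsMinresIterate H g t u)
    (hv : v ∈ krylov H g t) : inner ℝ (residual H g u) (H v) = 0 := by
  have h := (((krylov H g t).map H).norm_eq_iInf_iff_real_inner_eq_zero (u := -g)
    (Submodule.mem_map_of_mem hu.1)).1 ?_ (H v) (Submodule.mem_map_of_mem hv)
  · rwa [residual, neg_sub_comm]
  refine le_antisymm (le_ciInf ?_) (ciInf_le (f := fun w : (krylov H g t).map H => ‖-g - w‖)
    ⟨0, by rintro _ ⟨_, rfl⟩; exact norm_nonneg _⟩ ⟨H u, Submodule.mem_map_of_mem hu.1⟩)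
  rintro ⟨_, v', hv', rfl⟩
  rw [← neg_add', norm_neg, ← neg_add', norm_neg, add_comm, add_comm g]
  exact hu.2 v' hv'

lemma IsMinresIterate.eq_zero {u : E} (hu : IsMinresIterate H g 0 u) : u = 0 := by
  simpa [krylov_zero] using hu.1

lemma IsMinresIterate.inner_residual_self {u : E} (hu : IsMinresIterate H g t u) :
    inner ℝ g (residual H g u) = -‖residual H g u‖ ^ 2 := by
  have h := hu.inner_residual_map hu.1
  have hg : g = -H u - residual H g u := by rw [residual]; abel
  nth_rewrite 1 [hg]
  rw [inner_sub_left, inner_neg_left, real_inner_comm, h, real_inner_self_eq_norm_sq]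
  ring

/-- The later residual is orthogonal to the difference of two residuals. -/
lemma IsMinresIterate.inner_residual {u v : E} {j : ℕ} (hu : IsMinresIterate H g t u)
    (hv : IsMinresIterate H g j v) (hjt : j ≤ t) :
    inner ℝ (residual H g u) (residual H g v) = ‖residual H g u‖ ^ 2 := by
  have h := hu.inner_residual_map (sub_mem hu.1 (krylov_mono H g hjt hv.1))
  have e : residual H g v = residual H g u + H (u - v) := by
    simp only [residual, map_sub]; abel
  rw [e, inner_add_right, h, real_inner_self_eq_norm_sq, add_zero]

lemma inner_residual_map_eq_zero_of_lt (hs : ∀ t, IsMinresIterate H g t (s t)) {i j : ℕ}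
    (hji : j < i) : inner ℝ (residual H g (s i)) (H (residual H g (s j))) = 0 :=
  (hs i).inner_residual_map (krylov_mono H g hji (residual_mem_krylov_succ (hs j).1))

/-- The MINRES residuals are conjugate with respect to `H`. -/
lemma inner_residual_map_eq_zero (hsym : H.IsSymmetric)
    (hs : ∀ t, IsMinresIterate H g t (s t)) {i j : ℕ} (hij : i ≠ j) :
    inner ℝ (residual H g (s i)) (H (residual H g (s j))) = 0 := by
  rcases lt_or_gt_of_ne hij with h | h
  · rw [← hsym, real_inner_comm]
    exact inner_residual_map_eq_zero_of_lt hs h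
  · exact inner_residual_map_eq_zero_of_lt hs h

lemma inner_residual_map_sum (hsym : H.IsSymmetric) (hs : ∀ t, IsMinresIterate H g t (s t))
    (c : Fin t → ℝ) (i : Fin t) :
    inner ℝ (residual H g (s i)) (H (∑ j : Fin t, c j • residual H g (s j))) =
      c i * inner ℝ (residual H g (s i)) (H (residual H g (s i))) := by
  simp only [map_sum, map_smul, inner_sum, inner_smul_right]
  refine Finset.sum_eq_single i (fun j _ hj => ?_) (by simp)
  rw [inner_residual_map_eq_zero hsym hs (by simpa [Fin.ext_iff] using hj.symm), mul_zero]

lemma inner_map_self_pos_of_not_curvatureTest {θ : ℝ} {r : E} (hθ : 0 ≤ θ) (h : ¬ CurvatureTest H θ r) :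
    0 < inner ℝ r (H r) :=
  (mul_nonneg hθ (sq_nonneg _)).trans_lt (not_le.1 h)

/-- Conjugate residuals of positive curvature are linearly independent. -/
lemma linearIndependent_residual {θ : ℝ} (hθ : 0 ≤ θ) (hsym : H.IsSymmetric)
    (hs : ∀ t, IsMinresIterate H g t (s t))
    (hcurv : ∀ j < t, ¬ CurvatureTest H θ (residual H g (s j))) :
    LinearIndependent ℝ fun j : Fin t => residual H g (s j) := by
  refine Fintype.linearIndependent_iff.2 fun c hc i => ?_
  have h := inner_residual_map_sum hsym hs c i
  rw [hc, map_zero, inner_zero_right, zero_eq_mul] at h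
  exact h.resolve_right (inner_map_self_pos_of_not_curvatureTest hθ (hcurv i i.2)).ne'

lemma span_residual_eq_krylov {θ : ℝ} (hθ : 0 ≤ θ) (hsym : H.IsSymmetric)
    (hs : ∀ t, IsMinresIterate H g t (s t))
    (hcurv : ∀ j < t, ¬ CurvatureTest H θ (residual H g (s j))) :
    Submodule.span ℝ (Set.range fun j : Fin t => residual H g (s j)) = krylov H g t := by
  refine Submodule.eq_of_le_of_finrank_le (Submodule.span_le.2 ?_) ?_
  · rintro _ ⟨j, rfl⟩
    exact krylov_mono H g j.2 (residual_mem_krylov_succ (hs j).1)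
  · rw [finrank_span_eq_card (linearIndependent_residual hθ hsym hs hcurv), Fintype.card_fin]
    exact finrank_krylov_le H g t

/-- As long as the residuals have sufficient curvature, the MINRES iterates are descent directions.
In the basis of `K_t` formed by the residuals `r_i`, the coordinates of `s_t` are
`c_i = (‖r_i‖² - ‖r_t‖²) / ⟨r_i, H r_i⟩ ≥ 0`, by conjugacy and by
`⟨r_t, r_i⟩ = ‖r_t‖²`. As `⟨g, r_i⟩ = -‖r_i‖²`, this gives
`⟨g, s_t⟩ ≤ -⟨s_t, H s_t⟩`, and the curvature of `s_t` is bounded below by that of the `t` terms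
`c_i r_i`. -/
lemma inner_iterate_le {θ ς : ℝ} (hθ : 0 ≤ θ) (hς : 0 ≤ ς) (htς : t * ς ≤ θ)
    (hsym : H.IsSymmetric) (hs : ∀ t, IsMinresIterate H g t (s t))
    (hcurv : ∀ j < t, ¬ CurvatureTest H θ (residual H g (s j))) :
    inner ℝ g (s t) ≤ -(ς * ‖s t‖ ^ 2) := by
  obtain ⟨c, hc⟩ := (Submodule.mem_span_range_iff_exists_fun ℝ).1
    ((span_residual_eq_krylov hθ hsym hs hcurv).symm ▸ (hs t).1)
  have hpos (i : Fin t) := inner_map_self_pos_of_not_curvatureTest hθ (hcurv i i.2)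
  have hcoord (i : Fin t) : c i * inner ℝ (residual H g (s i)) (H (residual H g (s i))) =
      ‖residual H g (s i)‖ ^ 2 - ‖residual H g (s t)‖ ^ 2 := by
    have e : H (s t) = -g - residual H g (s t) := by rw [residual]; abel
    rw [← inner_residual_map_sum hsym hs c i, hc, e, inner_sub_right, inner_neg_right,
      real_inner_comm, (hs i).inner_residual_self, real_inner_comm,
      (hs t).inner_residual (hs i) i.2.le, neg_neg]
  have hc0 (i : Fin t) : 0 ≤ c i := by
    refine nonneg_of_mul_nonneg_left ?_ (hpos i)
    rw [hcoord, sub_nonneg, norm_residual, norm_residual]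
    have := (hs t).2 _ (krylov_mono H g i.2.le (hs i).1)
    gcongr
  have hg : inner ℝ g (s t) = -∑ i : Fin t, c i * ‖residual H g (s i)‖ ^ 2 := by
    rw [← hc, inner_sum, ← Finset.sum_neg_distrib]
    refine Finset.sum_congr rfl fun i _ => ?_
    rw [inner_smul_right, (hs i).inner_residual_self, mul_neg]
  have hnorm : ‖s t‖ ^ 2 ≤ t * ∑ i : Fin t, c i ^ 2 * ‖residual H g (s i)‖ ^ 2 := by
    calc ‖s t‖ ^ 2 ≤ (∑ i : Fin t, c i * ‖residual H g (s i)‖) ^ 2 := by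
          gcongr
          nth_rewrite 1 [← hc]
          refine (norm_sum_le _ _).trans_eq (Finset.sum_congr rfl fun i _ => ?_)
          rw [norm_smul, Real.norm_of_nonneg (hc0 i)]
      _ ≤ _ := by
          refine sq_sum_le_card_mul_sum_sq.trans_eq ?_
          simp [mul_pow]
  rw [hg, neg_le_neg_iff]
  calc ς * ‖s t‖ ^ 2 ≤ ς * (t * ∑ i : Fin t, c i ^ 2 * ‖residual H g (s i)‖ ^ 2) := by gcongr
    _ = (t * ς) * ∑ i : Fin t, c i ^ 2 * ‖residual H g (s i)‖ ^ 2 := by ring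
    _ ≤ θ * ∑ i : Fin t, c i ^ 2 * ‖residual H g (s i)‖ ^ 2 := by gcongr
    _ = ∑ i : Fin t, c i ^ 2 * (θ * ‖residual H g (s i)‖ ^ 2) := by
        rw [Finset.mul_sum]; exact Finset.sum_congr rfl fun i _ => by ring
    _ ≤ ∑ i : Fin t, c i ^ 2 * inner ℝ (residual H g (s i)) (H (residual H g (s i))) := by
        gcongr with i _
        exact (not_le.1 (hcurv i i.2)).le
    _ = ∑ i : Fin t, c i * (‖residual H g (s i)‖ ^ 2 - ‖residual H g (s t)‖ ^ 2) :=
        Finset.sum_congr rfl fun i _ => by rw [← hcoord]; ring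
    _ ≤ ∑ i : Fin t, c i * ‖residual H g (s i)‖ ^ 2 := by
        gcongr with i _
        · exact hc0 i
        · exact sub_le_self _ (sq_nonneg _)

lemma residual_iterate_zero (hs : ∀ t, IsMinresIterate H g t (s t)) :
    residual H g (s 0) = -g := by
  rw [(hs 0).eq_zero]; simp [residual]

/-- MINRES returns: at most `dim E` residuals can have sufficient curvature. -/
theorem exists_minresReturns [FiniteDimensional ℝ E] {θ : ℝ} (η : ℝ) (hθ : 0 ≤ θ)
    (hsym : H.IsSymmetric) (g : E) : ∃ p D, MinresReturns H g η θ p D := by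
  classical
  by_cases hg : g = 0
  · exact ⟨0, _, Or.inl ⟨hg, rfl, rfl⟩⟩
  choose s hs using exists_isMinresIterate H g
  have hex : ∃ t, CurvatureTest H θ (residual H g (s t)) ∨ InexactnessTest H g η (s (t + 1)) := by
    by_contra! h
    have := (linearIndependent_residual (t := Module.finrank ℝ E + 1) hθ hsym hs
      fun j _ => (h j).1).fintype_card_le_finrank
    simp at this
  have hlt : ∀ j < Nat.find hex, ¬ CurvatureTest H θ (residual H g (s j)) ∧
      ¬ InexactnessTest H g η (s (j + 1)) := fun j hj => not_or.1 (Nat.find_min hex hj)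
  by_cases hc : CurvatureTest H θ (residual H g (s (Nat.find hex)))
  · exact ⟨_, _, Or.inr ⟨hg, s, hs, _, hlt, Or.inl ⟨hc, rfl, rfl⟩⟩⟩
  · exact ⟨_, _, Or.inr ⟨hg, s, hs, _, hlt,
      Or.inr ⟨hc, (Nat.find_spec hex).resolve_left hc, rfl, rfl⟩⟩⟩

/-- The direction returned by MINRES is a descent direction, at least as long as a multiple of `‖g‖`,
with constants that do not depend on the dimension. -/
theorem MinresReturns.direction [FiniteDimensional ℝ E] {η θ ς L : ℝ} {p : E} {D : StepType}
    (h : MinresReturns H g η θ p D) (hη : 0 < η) (hς : 0 < ς)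
    (hθ : (Module.finrank ℝ E + 1) * ς ≤ θ) (hL : 0 ≤ L) (hsym : H.IsSymmetric)
    (hH : ∀ v, ‖H v‖ ≤ L * ‖v‖) :
    inner ℝ g p ≤ -(min 1 ς * ‖p‖ ^ 2) ∧ ‖g‖ ≤ (1 + L / η + (L + η) * L / ς) * ‖p‖ ∧
      (D = StepType.npc → p ≠ 0) := by
  have hςθ : ς ≤ θ := by
    have : (0 : ℝ) ≤ Module.finrank ℝ E * ς := by positivity
    linarith
  have hθ0 : 0 < θ := hς.trans_le hςθ
  have k1 : 0 ≤ L / η := by positivity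
  have k2 : 0 ≤ (L + η) * L / ς := by positivity
  rcases h with ⟨rfl, rfl, rfl⟩ | ⟨hg, s, hs, t, hlt, ⟨-, rfl, rfl⟩ | ⟨hcurv, hin, rfl, rfl⟩⟩
  · simp
  · have hgr : ‖g‖ ≤ (1 + L / η) * ‖residual H g (s t)‖ := by
      rcases t with _ | t
      · rw [residual_iterate_zero hs, norm_neg]
        nlinarith [norm_nonneg g]
      · have h1 : η * ‖H (s (t + 1))‖ < ‖H (residual H g (s (t + 1)))‖ :=
          not_le.1 (hlt t t.lt_succ_self).2
        have h2 : ‖H (s (t + 1))‖ ≤ L / η * ‖residual H g (s (t + 1))‖ := by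
          rw [div_mul_eq_mul_div, le_div_iff₀ hη, mul_comm]
          exact h1.le.trans (hH _)
        have h3 : g = -H (s (t + 1)) - residual H g (s (t + 1)) := by rw [residual]; abel
        calc ‖g‖ ≤ ‖H (s (t + 1))‖ + ‖residual H g (s (t + 1))‖ := by
              nth_rewrite 1 [h3]
              exact (norm_sub_le _ _).trans_eq (by rw [norm_neg])
          _ ≤ _ := by linarith
    refine ⟨?_, hgr.trans (mul_le_mul_of_nonneg_right (by linarith) (norm_nonneg _)), fun _ h0 => hg ?_⟩
    · rw [(hs t).inner_residual_self, neg_le_neg_iff]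
      exact mul_le_of_le_one_left (sq_nonneg _) (min_le_left _ _)
    · rw [h0, norm_zero, mul_zero] at hgr
      exact norm_le_zero_iff.1 hgr
  · have hcurv' : ∀ j < t + 1, ¬ CurvatureTest H θ (residual H g (s j)) := fun j hj => by
      rcases (Nat.lt_succ_iff_lt_or_eq.1 hj) with h | rfl
      exacts [(hlt j h).1, hcurv]
    have ht : ((t + 1 : ℕ) : ℝ) * ς ≤ θ := by
      refine le_trans ?_ hθ
      have := (linearIndependent_residual hθ0.le hsym hs hcurv').fintype_card_le_finrank
      rw [Fintype.card_fin] at this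
      have h' : ((t + 1 : ℕ) : ℝ) ≤ Module.finrank ℝ E := by exact_mod_cast this
      gcongr
      linarith
    refine ⟨?_, ?_, by simp⟩
    · refine (inner_iterate_le hθ0.le hς.le ht hsym hs hcurv').trans ?_
      gcongr
      exact min_le_right _ _
    -- Since `H g = -H (H s) - H r`, the inexactness test bounds `H g`, and `H` has curvature
    -- more than `θ` along the first residual `-g`.
    · have h0 : θ * ‖g‖ ^ 2 < inner ℝ g (H g) := by
        have := not_le.1 (hcurv' 0 t.succ_pos)
        rwa [residual_iterate_zero hs, map_neg, inner_neg_neg, norm_neg] at this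
      have h1 : θ * ‖g‖ ≤ ‖H g‖ := by
        have hg0 : 0 < ‖g‖ := norm_pos_iff.2 hg
        have := real_inner_le_norm g (H g)
        nlinarith
      have h2 : ‖H g‖ ≤ (L + η) * ‖H (s (t + 1))‖ := by
        have e : H g = -H (H (s (t + 1))) - H (residual H g (s (t + 1))) := by
          simp only [residual, map_sub, map_neg]; abel
        have h3 : ‖H g‖ ≤ ‖H (H (s (t + 1)))‖ + ‖H (residual H g (s (t + 1)))‖ := by
          rw [e]
          exact (norm_sub_le _ _).trans_eq (by rw [norm_neg])
        have h4 := hH (H (s (t + 1)))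
        have h5 : _ ≤ _ := hin
        linarith
      have h3 : ‖g‖ ≤ (L + η) * L / ς * ‖s (t + 1)‖ := by
        rw [div_mul_eq_mul_div, le_div_iff₀ hς, mul_comm]
        calc ς * ‖g‖ ≤ θ * ‖g‖ := by gcongr
          _ ≤ (L + η) * ‖H (s (t + 1))‖ := h1.trans h2
          _ ≤ (L + η) * (L * ‖s (t + 1)‖) := by gcongr; exact hH _
          _ = _ := by ring
      exact h3.trans (by gcongr; linarith)

end Minres

/-! ### Smoothness on the nonnegative orthant -/

/-- The descent lemma on a convex set. -/
lemma le_add_inner_gradient_add_sq {E : Type*} [NormedAddCommGroup E] [InnerProductSpace ℝ E]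
    [CompleteSpace E] {f : E → ℝ} {s : Set E} {L : ℝ} (hf : Differentiable ℝ f)
    (hs : Convex ℝ s)
    (hlip : ∀ x ∈ s, ∀ y ∈ s, ‖gradient f x - gradient f y‖ ≤ L * ‖x - y‖)
    {x y : E} (hx : x ∈ s) (hy : y ∈ s) :
    f y ≤ f x + inner ℝ (gradient f x) (y - x) + L / 2 * ‖y - x‖ ^ 2 := by
  set v := y - x with hv
  have hline (t : ℝ) : HasDerivAt (fun t : ℝ => x + t • v) v t := by
    simpa using ((hasDerivAt_id t).smul_const v).const_add x
  have hd (t : ℝ) : HasDerivAt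
      (fun t : ℝ => f (x + t • v) - t * inner ℝ (gradient f x) v - L / 2 * ‖v‖ ^ 2 * t ^ 2)
      (inner ℝ (gradient f (x + t • v) - gradient f x) v - L * ‖v‖ ^ 2 * t) t := by
    have h1 := ((hf (x + t • v)).hasFDerivAt.comp_hasDerivAt t (hline t))
    have h2 := (hasDerivAt_id t).mul_const (inner ℝ (gradient f x) v)
    have h3 := ((hasDerivAt_id t).pow 2).const_mul (L / 2 * ‖v‖ ^ 2)
    refine ((h1.sub h2).sub h3).congr_deriv ?_
    rw [inner_sub_left, inner_gradient_left]
    simp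
    ring
  have hanti := antitoneOn_of_deriv_nonpos (convex_Icc (0 : ℝ) 1)
    (fun t _ => (hd t).continuousAt.continuousWithinAt)
    (fun t _ => (hd t).differentiableAt.differentiableWithinAt) (fun t ht => by
      rw [interior_Icc] at ht
      have hmem : x + t • v ∈ s := hs.add_smul_sub_mem hx hy ⟨ht.1.le, ht.2.le⟩
      have h1 := hlip _ hmem x hx
      rw [add_sub_cancel_left, norm_smul, Real.norm_of_nonneg ht.1.le] at h1
      have h2 := real_inner_le_norm (gradient f (x + t • v) - gradient f x) v
      have h3 := mul_le_mul_of_nonneg_right h1 (norm_nonneg v)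
      rw [(hd t).deriv]
      linarith)
  have h := hanti (Set.left_mem_Icc.2 zero_le_one) (Set.right_mem_Icc.2 zero_le_one) zero_le_one
  simp only [one_smul, zero_smul, add_zero, hv, add_sub_cancel] at h
  rw [← hv] at h
  linarith

variable {d : ℕ}

lemma convex_orthant : Convex ℝ (orthant d) := by
  intro x hx y hy a b ha hb _ i
  have := hx i
  have := hy i
  simp only [PiLp.add_apply, PiLp.smul_apply, smul_eq_mul]
  positivity

lemma proj_mem_orthant (x : EuclideanSpace ℝ (Fin d)) : proj x ∈ orthant d :=
  fun _ => le_max_right _ _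

/-- The vector whose components with index in `S` are those of `v`, and whose other components are
those of `w`. -/
noncomputable def glue (S : Finset (Fin d)) (v : EuclideanSpace ℝ S)
    (w : EuclideanSpace ℝ (Fin d)) : EuclideanSpace ℝ (Fin d) :=
  WithLp.toLp 2 fun i => if h : i ∈ S then v ⟨i, h⟩ else w i

lemma subvec_glue (S : Finset (Fin d)) (v : EuclideanSpace ℝ S) (w : EuclideanSpace ℝ (Fin d)) :
    subvec S (glue S v w) = v := by
  ext i; simp [subvec, glue]

lemma glue_apply_of_notMem {S : Finset (Fin d)} {i : Fin d} (hi : i ∉ S)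
    (v : EuclideanSpace ℝ S) (w : EuclideanSpace ℝ (Fin d)) : glue S v w i = w i := by
  simp [glue, hi]

lemma norm_sq_subvec (S : Finset (Fin d)) (v : EuclideanSpace ℝ (Fin d)) :
    ‖subvec S v‖ ^ 2 = ∑ i ∈ S, v i ^ 2 := by
  rw [EuclideanSpace.real_norm_sq_eq]
  exact Finset.sum_coe_sort S fun i => v i ^ 2

lemma inner_subvec (S : Finset (Fin d)) (v w : EuclideanSpace ℝ (Fin d)) :
    inner ℝ (subvec S v) (subvec S w) = ∑ i ∈ S, v i * w i := by
  rw [← Finset.sum_coe_sort S fun i => v i * w i, PiLp.inner_apply]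
  simp [subvec, mul_comm]

lemma norm_subvec_le (S : Finset (Fin d)) (v : EuclideanSpace ℝ (Fin d)) :
    ‖subvec S v‖ ≤ ‖v‖ := by
  rw [← sq_le_sq₀ (norm_nonneg _) (norm_nonneg _), norm_sq_subvec, EuclideanSpace.real_norm_sq_eq]
  exact Finset.sum_le_univ_sum_of_nonneg fun i => sq_nonneg _

lemma norm_glue_zero (S : Finset (Fin d)) (v : EuclideanSpace ℝ S) : ‖glue S v 0‖ = ‖v‖ := by
  rw [← sq_eq_sq₀ (norm_nonneg _) (norm_nonneg _), EuclideanSpace.real_norm_sq_eq]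
  nth_rewrite 2 [← subvec_glue S v 0]
  rw [norm_sq_subvec]
  refine (Finset.sum_subset (Finset.subset_univ S) fun i _ hi => ?_).symm
  rw [glue_apply_of_notMem hi]; simp

variable {f : EuclideanSpace ℝ (Fin d) → ℝ}

lemma contDiff_gradient (hf : ContDiff ℝ 2 f) : ContDiff ℝ 1 (gradient f) :=
  (InnerProductSpace.toDual ℝ (EuclideanSpace ℝ (Fin d))).symm.contDiff.comp
    (hf.fderiv_right (m := 1) (by norm_num))

lemma fderiv_gradient_apply (hf : ContDiff ℝ 2 f) (x v w : EuclideanSpace ℝ (Fin d)) :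
    inner ℝ (fderiv ℝ (gradient f) x v) w = fderiv ℝ (fderiv ℝ f) x v w := by
  have h : HasFDerivAt (fderiv ℝ f) (fderiv ℝ (fderiv ℝ f) x) x :=
    ((hf.fderiv_right (m := 1) (by norm_num)).differentiable (by norm_num) x).hasFDerivAt
  have h1 := (InnerProductSpace.toDual ℝ (EuclideanSpace ℝ (Fin d))).symm.toContinuousLinearEquiv
    |>.toContinuousLinearMap.hasFDerivAt.comp x h
  have h2 : HasFDerivAt (gradient f) _ x := h1
  rw [h2.fderiv]
  exact InnerProductSpace.toDual_symm_apply

lemma hessian_isHermitian (hf : ContDiff ℝ 2 f) (x : EuclideanSpace ℝ (Fin d)) :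
    (hessian f x).IsHermitian := by
  have hsymm : IsSymmSndFDerivAt ℝ f x := hf.contDiffAt.isSymmSndFDerivAt (by simp)
  have e (i j : Fin d) : hessian f x i j =
      fderiv ℝ (fderiv ℝ f) x (EuclideanSpace.single j 1) (EuclideanSpace.single i 1) := by
    rw [← fderiv_gradient_apply hf, EuclideanSpace.inner_single_right]
    simp [hessian]
  ext i j
  rw [Matrix.conjTranspose_apply, e, e, star_trivial]
  exact hsymm _ _

lemma isSymmetric_subHessian (hf : ContDiff ℝ 2 f) (x : EuclideanSpace ℝ (Fin d))
    (S : Finset (Fin d)) : (subHessian f x S).IsSymmetric :=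
  Matrix.isSymmetric_toEuclideanLin_iff.2 ((hessian_isHermitian hf x).submatrix _)

lemma subHessian_apply (f : EuclideanSpace ℝ (Fin d) → ℝ) (x : EuclideanSpace ℝ (Fin d))
    (S : Finset (Fin d)) (v : EuclideanSpace ℝ S) :
    subHessian f x S v = subvec S (fderiv ℝ (gradient f) x (glue S v 0)) := by
  have e : glue S v 0 = ∑ j : S, v j • EuclideanSpace.single (j : Fin d) (1 : ℝ) := by
    ext i
    by_cases hi : i ∈ S
    · rw [WithLp.ofLp_sum, Finset.sum_apply, Finset.sum_eq_single ⟨i, hi⟩]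
      · simp [glue, hi]
      · intro j _ hj
        have : i ≠ j := fun h => hj (Subtype.ext h.symm)
        simp [this]
      · simp
    · rw [WithLp.ofLp_sum, Finset.sum_apply, glue_apply_of_notMem hi, Finset.sum_eq_zero]
      · rfl
      · intro j _
        have : i ≠ j := fun h => hi (h ▸ j.2)
        simp [this]
  rw [e]
  ext i
  simp [subHessian, subvec, hessian, Matrix.mulVec, dotProduct, mul_comm]

/-- A gradient that is `L`-Lipschitz on the orthant only still bounds the principal submatrices of
the Hessian with indices of positive components, because such components can move in both
directions without leaving the orthant. -/
lemma norm_subHessian_le {L : ℝ} (hf : ContDiff ℝ 2 f) (hL : 0 ≤ L)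
    (hlip : ∀ x ∈ orthant d, ∀ y ∈ orthant d, ‖gradient f x - gradient f y‖ ≤ L * ‖x - y‖)
    {x : EuclideanSpace ℝ (Fin d)} (hx : x ∈ orthant d) {S : Finset (Fin d)}
    (hS : ∀ i ∈ S, 0 < x i) (v : EuclideanSpace ℝ S) : ‖subHessian f x S v‖ ≤ L * ‖v‖ := by
  rw [subHessian_apply, ← norm_glue_zero S v]
  refine (norm_subvec_le _ _).trans ?_
  set w := glue S v 0 with hw
  have hline : HasDerivAt (fun t : ℝ => x + t • w) w 0 := by
    simpa using ((hasDerivAt_id (0 : ℝ)).smul_const w).const_add x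
  have hgrad : HasFDerivAt (gradient f) (fderiv ℝ (gradient f) x) (x + (0 : ℝ) • w) := by
    rw [zero_smul, add_zero]
    exact ((contDiff_gradient hf).differentiable (by norm_num) x).hasFDerivAt
  refine (hgrad.comp_hasDerivAt 0 hline).le_of_lip' (by positivity) ?_
  have hmem : ∀ᶠ t : ℝ in nhds 0, ∀ i, 0 ≤ (x + t • w) i := by
    refine Filter.eventually_all.2 fun i => ?_
    by_cases hi : i ∈ S
    · have hc : ContinuousAt (fun t : ℝ => x i + t * w i) 0 := by fun_prop
      refine (hc.eventually (lt_mem_nhds (a := 0) ?_)).mono fun t ht => ?_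
      · simpa using hS i hi
      · simpa using ht.le
    · refine Filter.Eventually.of_forall fun t => ?_
      have : w i = 0 := glue_apply_of_notMem hi v 0
      simpa [this] using hx i
  filter_upwards [hmem] with t ht
  refine (hlip _ ht _ (by simpa using hx)).trans_eq ?_
  simp [norm_smul]
  ring

/-! ### Line searches -/

lemma exists_backtrackReturns {crit : ℝ → Prop} {ζ a : ℝ} (hζ : 0 < ζ) (hζ' : ζ < 1) (ha : 0 < a)
    (h : ∀ α, 0 < α → α ≤ a → crit α) : ∃ α, BacktrackReturns crit ζ 1 α := by
  classical
  have hex : ∃ m : ℕ, crit (ζ ^ m * 1) := by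
    obtain ⟨m, hm⟩ := exists_pow_lt_of_lt_one ha hζ'
    exact ⟨m, h _ (by positivity) (by simpa using hm.le)⟩
  exact ⟨_, Nat.find hex, rfl, Nat.find_spec hex, fun j hj => Nat.find_min hex hj⟩

lemma exists_forwardTrackReturns {crit : ℝ → Prop} {ζ a : ℝ} (hζ : 0 < ζ) (hζ' : ζ < 1)
    (ha : 0 < a) (h : ∀ α, 0 < α → α ≤ a → crit α) (hfail : ∃ b, ∀ α, b < α → ¬ crit α) :
    ∃ α, ForwardTrackReturns crit ζ 1 α := by
  classical
  by_cases h1 : crit 1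
  · have hex : ∃ m : ℕ, ¬ crit (1 / ζ ^ m) := by
      obtain ⟨b, hb⟩ := hfail
      obtain ⟨m, hm⟩ := pow_unbounded_of_one_lt b ((one_lt_inv₀ hζ).2 hζ')
      exact ⟨m, hb _ (by simpa using hm)⟩
    exact ⟨_, Or.inr ⟨h1, Nat.find hex, rfl, Nat.find_spec hex,
      fun j hj => not_not.1 (Nat.find_min hex hj)⟩⟩
  · obtain ⟨α, hα⟩ := exists_backtrackReturns hζ hζ' ha h
    exact ⟨α, Or.inl ⟨h1, hα⟩⟩

/-- The step size returned by backtracking is accepted, and it is either the initial step `1` or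
`ζ` times a rejected step. -/
lemma BacktrackReturns.spec {crit : ℝ → Prop} {ζ α : ℝ} (hζ : 0 < ζ)
    (h : BacktrackReturns crit ζ 1 α) :
    0 < α ∧ crit α ∧ (1 ≤ α ∨ ¬ crit (α / ζ)) := by
  obtain ⟨m, rfl, hm, hlt⟩ := h
  refine ⟨by positivity, hm, ?_⟩
  rcases m with _ | m
  · simp
  · right
    convert hlt m m.lt_succ_self using 2
    rw [mul_one, mul_one, pow_succ, mul_div_assoc, div_self hζ.ne', mul_one]

lemma ForwardTrackReturns.spec {crit : ℝ → Prop} {ζ α : ℝ} (hζ : 0 < ζ) (hζ' : ζ < 1)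
    (h : ForwardTrackReturns crit ζ 1 α) :
    0 < α ∧ crit α ∧ (1 ≤ α ∨ ¬ crit (α / ζ)) := by
  rcases h with ⟨-, h⟩ | ⟨h1, m, rfl, hm, hlt⟩
  · exact h.spec hζ
  · rcases m with _ | m
    · exact absurd (by simpa using h1) hm
    · have e : ζ * (1 / ζ ^ (m + 1)) = 1 / ζ ^ m := by
        rw [pow_succ]; field_simp
      rw [e]
      exact ⟨by positivity, hlt m m.lt_succ_self,
        Or.inl ((one_le_div (by positivity)).2 (pow_le_one₀ hζ.le hζ'.le))⟩

/-! ### One projected gradient coordinate -/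

lemma mul_mul_max_sub_le {x g α : ℝ} (hx : 0 ≤ x) :
    α * (g * (max (x - α * g) 0 - x)) ≤ -(max (x - α * g) 0 - x) ^ 2 := by
  rcases max_cases (x - α * g) 0 with ⟨e, _⟩ | ⟨e, _⟩ <;> rw [e] <;> nlinarith

lemma mul_max_sub_nonpos {x g α : ℝ} (hx : 0 ≤ x) (hα : 0 < α) :
    g * (max (x - α * g) 0 - x) ≤ 0 := by
  have := mul_mul_max_sub_le (g := g) (α := α) hx
  refine nonpos_of_mul_nonpos_right (this.trans ?_) hα
  exact neg_nonpos.2 (sq_nonneg _)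

lemma mul_max_sub_eq {x g α : ℝ} (hx : 0 ≤ x) (hα : 0 < α) (hg : g < 0) :
    g * (max (x - α * g) 0 - x) = -(α * g ^ 2) := by
  rw [max_eq_left (by nlinarith)]; ring

lemma mul_max_sub_le_min {x g α τ : ℝ} (hx : 0 ≤ x) (hx1 : x ≤ 1) (hτ : 0 < τ) (hτ1 : τ ≤ 1)
    (hα : τ ≤ α) : g * (max (x - α * g) 0 - x) ≤ -(τ * min ((x * g) ^ 2) 1) := by
  have hsq : (x * g) ^ 2 ≤ g ^ 2 := by
    rw [mul_pow]
    exact mul_le_of_le_one_left (sq_nonneg _) (pow_le_one₀ hx hx1)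
  rcases max_cases (x - α * g) 0 with ⟨e, _⟩ | ⟨e, h⟩ <;> rw [e]
  · have h1 : τ * min ((x * g) ^ 2) 1 ≤ α * g ^ 2 :=
      mul_le_mul hα ((min_le_left _ _).trans hsq) (by positivity) (hτ.le.trans hα)
    linarith
  · have hg : 0 < g := by
      by_contra! hg
      nlinarith
    have h0 : 0 ≤ x * g := by positivity
    have h1 : min ((x * g) ^ 2) 1 ≤ x * g := by
      rcases le_total (x * g) 1 with h | h
      · exact (min_le_left _ _).trans (by nlinarith)
      · exact (min_le_right _ _).trans h
    have h2 : (0 : ℝ) ≤ min ((x * g) ^ 2) 1 := by positivity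
    nlinarith

/-! ### The step of the two-metric projection method -/

variable {x p : EuclideanSpace ℝ (Fin d)}
  {δ ρ α c : ℝ}

lemma sum_activeSet_add_sum_inactiveSet (hx : x ∈ orthant d) (δ : ℝ) (u : Fin d → ℝ) :
    ∑ i, u i = ∑ i ∈ activeSet x δ, u i + ∑ i ∈ inactiveSet x δ, u i := by
  rw [← Finset.sum_filter_add_sum_filter_not Finset.univ (fun i => x i ≤ δ) u]
  simp [activeSet, inactiveSet, hx _]

lemma apply_of_mem_activeSet {i : Fin d} (hi : i ∈ activeSet x δ) : 0 ≤ x i ∧ x i ≤ δ := by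
  simpa [activeSet] using hi

lemma proj_apply_of_mem_activeSet (hp : ∀ i ∈ activeSet x δ, p i = -gradient f x i) {i : Fin d}
    (hi : i ∈ activeSet x δ) (α : ℝ) :
    proj (x + α • p) i = max (x i - α * gradient f x i) 0 := by
  simp [proj, hp i hi, sub_eq_add_neg]

lemma sum_activeSet_nonpos (hp : ∀ i ∈ activeSet x δ, p i = -gradient f x i) (hα : 0 < α) :
    ∑ i ∈ activeSet x δ, gradient f x i * (proj (x + α • p) i - x i) ≤ 0 :=
  Finset.sum_nonpos fun i hi => by
    rw [proj_apply_of_mem_activeSet hp hi]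
    exact mul_max_sub_nonpos (apply_of_mem_activeSet hi).1 hα

/-- Short steps are accepted. The condition `α² ‖p^I‖² ≤ δ²` keeps the inactive components
positive, so that the projection acts on the active ones only. -/
lemma lineSearchCriterion_of_small {L : ℝ} (hf : Differentiable ℝ f) (hL : 0 ≤ L)
    (hlip : ∀ x ∈ orthant d, ∀ y ∈ orthant d, ‖gradient f x - gradient f y‖ ≤ L * ‖x - y‖)
    (hx : x ∈ orthant d) (hδ : 0 ≤ δ) (hρ' : ρ ≤ 1 / 2)
    (hp : ∀ i ∈ activeSet x δ, p i = -gradient f x i) (hc : 0 ≤ c) (hc1 : c ≤ 1)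
    (hdesc : ∑ i ∈ inactiveSet x δ, gradient f x i * p i ≤ -(c * ∑ i ∈ inactiveSet x δ, p i ^ 2))
    (hα : 0 < α) (hαL : α * L ≤ c) (hαp : α ^ 2 * ∑ i ∈ inactiveSet x δ, p i ^ 2 ≤ δ ^ 2) :
    LineSearchCriterion f δ ρ x p α := by
  have hinact : ∀ i ∈ inactiveSet x δ, proj (x + α • p) i - x i = α * p i := by
    intro i hi
    have h1 : (α * p i) ^ 2 ≤ δ ^ 2 := by
      rw [mul_pow]
      refine le_trans ?_ hαp
      gcongr
      exact Finset.single_le_sum (f := fun i => p i ^ 2) (fun i _ => sq_nonneg _) hi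
    have h2 : δ < x i := by simpa [inactiveSet] using hi
    have h3 := (abs_le_of_sq_le_sq' h1 hδ).1
    have : proj (x + α • p) i = max (x i + α * p i) 0 := rfl
    rw [this, max_eq_left (by linarith)]
    ring
  have hdl := le_add_inner_gradient_add_sq hf convex_orthant hlip hx (proj_mem_orthant (x + α • p))
  have e1 : inner ℝ (gradient f x) (proj (x + α • p) - x) =
      ∑ i ∈ activeSet x δ, gradient f x i * (proj (x + α • p) i - x i) +
        α * ∑ i ∈ inactiveSet x δ, gradient f x i * p i := by
    rw [PiLp.inner_apply, sum_activeSet_add_sum_inactiveSet hx δ, Finset.mul_sum]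
    congr 1
    · exact Finset.sum_congr rfl fun i _ => by simp [mul_comm]
    · refine Finset.sum_congr rfl fun i hi => ?_
      rw [PiLp.sub_apply, hinact i hi]
      simp
      ring
  have e2 : ‖proj (x + α • p) - x‖ ^ 2 =
      ∑ i ∈ activeSet x δ, (proj (x + α • p) i - x i) ^ 2 +
        α ^ 2 * ∑ i ∈ inactiveSet x δ, p i ^ 2 := by
    rw [EuclideanSpace.real_norm_sq_eq, sum_activeSet_add_sum_inactiveSet hx δ, Finset.mul_sum]
    congr 1
    refine Finset.sum_congr rfl fun i hi => ?_
    rw [PiLp.sub_apply, hinact i hi]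
    ring
  have hact : L * ∑ i ∈ activeSet x δ, (proj (x + α • p) i - x i) ^ 2 ≤
      -∑ i ∈ activeSet x δ, gradient f x i * (proj (x + α • p) i - x i) := by
    rw [Finset.mul_sum, ← Finset.sum_neg_distrib]
    refine Finset.sum_le_sum fun i hi => ?_
    rw [proj_apply_of_mem_activeSet hp hi]
    have hxi := (apply_of_mem_activeSet hi).1
    have h1 := mul_mul_max_sub_le (g := gradient f x i) (α := α) hxi
    have h2 := mul_max_sub_nonpos (g := gradient f x i) hxi hα
    have h3 := mul_le_mul_of_nonneg_left h1 hL
    have h4 := mul_le_mul_of_nonpos_right (hαL.trans hc1) h2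
    linarith
  have hA := sum_activeSet_nonpos hp hα
  have hq : 0 ≤ ∑ i ∈ inactiveSet x δ, p i ^ 2 := Finset.sum_nonneg fun i _ => sq_nonneg _
  rw [e1, e2] at hdl
  rw [LineSearchCriterion]
  set A := ∑ i ∈ activeSet x δ, gradient f x i * (proj (x + α • p) i - x i)
  set G := ∑ i ∈ inactiveSet x δ, gradient f x i * p i
  set q := ∑ i ∈ inactiveSet x δ, p i ^ 2
  have hG : G ≤ 0 := hdesc.trans (neg_nonpos.2 (by positivity))
  have hI : L * (α ^ 2 * q) ≤ -(α * G) := by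
    have h1 : α * L * (α * q) ≤ c * (α * q) := by gcongr
    have h2 := mul_le_mul_of_nonneg_left hdesc hα.le
    linarith
  have h1 : 1 / 2 * A ≤ ρ * A := mul_le_mul_of_nonpos_right hρ' hA
  have h2 : 1 / 2 * (α * G) ≤ ρ * (α * G) :=
    mul_le_mul_of_nonpos_right hρ' (mul_nonpos_of_nonneg_of_nonpos hα.le hG)
  linarith

/-- An accepted step that is not too short, either in step size or in length on the inactive set,
decreases `f` by a multiple of `ε²`, as long as the termination test fails. -/
lemma decrease_of_lineSearchCriterion {P : Params} {k : ℕ} {ε τ ζ κ : ℝ} (hε : 0 < ε) (hε1 : ε < 1)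
    (hδ : P.δ k = √ε) (hPε : P.ε k = √ε) (hρ : 0 < ρ) (hζ : 0 < ζ)
    (hτ : 0 < τ) (hτ1 : τ ≤ 1) (hc : 0 < c) (hκ : 0 < κ) (hterm : ¬ Terminates f P k x)
    (hp : ∀ i ∈ activeSet x (√ε), p i = -gradient f x i)
    (hdesc : ∑ i ∈ inactiveSet x (√ε), gradient f x i * p i ≤
      -(c * ∑ i ∈ inactiveSet x (√ε), p i ^ 2))
    (hnorm : ‖subvec (inactiveSet x (√ε)) (gradient f x)‖ ≤
      κ * ‖subvec (inactiveSet x (√ε)) p‖)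
    (hα : 0 < α) (hcrit : LineSearchCriterion f (√ε) ρ x p α)
    (hlong : τ ≤ α ∨ ζ ^ 2 * ε ≤ α ^ 2 * ∑ i ∈ inactiveSet x (√ε), p i ^ 2) :
    f (proj (x + α • p)) ≤ f x - ρ * min (c * ζ ^ 2) (min (τ * c / κ ^ 2) τ) * ε ^ 2 := by
  rw [Terminates, hδ, hPε, Real.sq_sqrt hε.le] at hterm
  rw [LineSearchCriterion] at hcrit
  have hεsq : ε ^ 2 ≤ ε := by nlinarith
  have hA := sum_activeSet_nonpos hp hα
  have hAi : ∀ i ∈ activeSet x (√ε), gradient f x i * (proj (x + α • p) i - x i) ≤ 0 :=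
    fun i hi => by
      rw [proj_apply_of_mem_activeSet hp hi]
      exact mul_max_sub_nonpos (apply_of_mem_activeSet hi).1 hα
  have hq : 0 ≤ ∑ i ∈ inactiveSet x (√ε), p i ^ 2 := Finset.sum_nonneg fun i _ => sq_nonneg _
  have hnorm2 : ‖subvec (inactiveSet x (√ε)) (gradient f x)‖ ^ 2 ≤
      κ ^ 2 * ∑ i ∈ inactiveSet x (√ε), p i ^ 2 := by
    rw [← norm_sq_subvec, ← mul_pow]
    gcongr
  set q := ∑ i ∈ inactiveSet x (√ε), p i ^ 2
  suffices h : min (c * ζ ^ 2) (min (τ * c / κ ^ 2) τ) * ε ^ 2 ≤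
      -(∑ i ∈ activeSet x (√ε), gradient f x i * (proj (x + α • p) i - x i)) + α * (c * q) by
    have h1 := mul_le_mul_of_nonneg_left h hρ.le
    have h2 := mul_le_mul_of_nonneg_left hdesc (mul_pos hα hρ).le
    linarith
  set A := ∑ i ∈ activeSet x (√ε), gradient f x i * (proj (x + α • p) i - x i) with hAdef
  by_cases hτα : τ ≤ α
  · have hαq : 0 ≤ α * (c * q) := by positivity
    suffices h : τ * ε ^ 2 ≤ -A ∨ τ * c / κ ^ 2 * ε ^ 2 ≤ α * (c * q) by
      rcases h with h | h
      · refine le_trans (mul_le_mul_of_nonneg_right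
          ((min_le_right _ _).trans (min_le_right _ _)) (sq_nonneg ε)) ?_
        linarith
      · refine le_trans (mul_le_mul_of_nonneg_right
          ((min_le_right _ _).trans (min_le_left _ _)) (sq_nonneg ε)) ?_
        linarith
    rw [not_and_or, not_and_or] at hterm
    rcases hterm with hterm | hterm | hterm
    · left
      push Not at hterm
      obtain ⟨i, hi, hgi⟩ := hterm
      have hneg : gradient f x i < 0 := hgi.trans_le (neg_nonpos.2 (Real.sqrt_nonneg _))
      have h1 := Finset.single_le_sum
        (f := fun i => -(gradient f x i * (proj (x + α • p) i - x i)))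
        (fun i hi => neg_nonneg.2 (hAi i hi)) hi
      rw [Finset.sum_neg_distrib, ← hAdef] at h1
      simp only at h1
      rw [proj_apply_of_mem_activeSet hp hi,
        mul_max_sub_eq (apply_of_mem_activeSet hi).1 hα hneg] at h1
      have h2 : ε ≤ gradient f x i ^ 2 := by
        have := Real.sq_sqrt hε.le
        have := Real.sqrt_nonneg ε
        nlinarith
      have h3 : τ * ε ^ 2 ≤ α * gradient f x i ^ 2 :=
        mul_le_mul hτα (hεsq.trans h2) (sq_nonneg ε) hα.le
      linarith
    · left
      rw [not_le, ← sq_lt_sq₀ hε.le (norm_nonneg _), norm_sq_subvec] at hterm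
      simp only at hterm
      have h1 : τ * ∑ i ∈ activeSet x (√ε), min ((x i * gradient f x i) ^ 2) 1 ≤ -A := by
        rw [hAdef, Finset.mul_sum, ← Finset.sum_neg_distrib]
        refine Finset.sum_le_sum fun i hi => ?_
        rw [proj_apply_of_mem_activeSet hp hi]
        have hxi := apply_of_mem_activeSet hi
        have hε' : √ε ≤ 1 := Real.sqrt_le_one.2 hε1.le
        linarith [mul_max_sub_le_min (g := gradient f x i) hxi.1 (hxi.2.trans hε') hτ hτ1 hτα]
      refine le_trans ?_ h1
      gcongr
      by_cases hbig : ∃ i ∈ activeSet x (√ε), 1 ≤ (x i * gradient f x i) ^ 2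
      · obtain ⟨i, hi, h⟩ := hbig
        have h2 := Finset.single_le_sum (f := fun i => min ((x i * gradient f x i) ^ 2) 1)
          (fun i _ => by positivity) hi
        simp only [min_eq_right h] at h2
        nlinarith
      · push Not at hbig
        rw [Finset.sum_congr rfl fun i hi => min_eq_left (hbig i hi).le]
        exact hterm.le
    · right
      rw [not_le, ← sq_lt_sq₀ hε.le (norm_nonneg _)] at hterm
      have h1 := hterm.le.trans hnorm2
      have h2 : τ * c * ε ^ 2 ≤ α * c * (κ ^ 2 * q) := by gcongr
      rw [div_mul_eq_mul_div, div_le_iff₀ (by positivity)]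
      linarith
  · -- Here `α < τ ≤ 1`, so `α ‖p^I‖² ≥ α² ‖p^I‖²` is bounded below.
    have h1 := hlong.resolve_left hτα
    have h2 : α ^ 2 * q ≤ α * q := by
      gcongr
      nlinarith
    have h3 : c * ζ ^ 2 * ε ^ 2 ≤ α * (c * q) := by
      have h4 : c * ζ ^ 2 * ε ^ 2 ≤ c * ζ ^ 2 * ε := by gcongr
      have h5 := mul_le_mul_of_nonneg_left (h1.trans h2) hc.le
      linarith
    refine le_trans (mul_le_mul_of_nonneg_right (min_le_left _ _) (sq_nonneg ε)) ?_
    linarith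

/-- Accepted steps of size at least `1`, and steps `α` for which `α / ζ` is rejected, are not too
short. -/
lemma le_or_le_of_not_lineSearchCriterion {L ζ : ℝ} (hf : Differentiable ℝ f) (hL : 0 ≤ L)
    (hlip : ∀ x ∈ orthant d, ∀ y ∈ orthant d, ‖gradient f x - gradient f y‖ ≤ L * ‖x - y‖)
    (hx : x ∈ orthant d) (hδ : 0 ≤ δ) (hρ' : ρ ≤ 1 / 2) (hζ : 0 < ζ) (hζ' : ζ < 1)
    (hp : ∀ i ∈ activeSet x δ, p i = -gradient f x i) (hc : 0 ≤ c) (hc1 : c ≤ 1)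
    (hdesc : ∑ i ∈ inactiveSet x δ, gradient f x i * p i ≤ -(c * ∑ i ∈ inactiveSet x δ, p i ^ 2))
    (hα : 0 < α) (h : 1 ≤ α ∨ ¬ LineSearchCriterion f δ ρ x p (α / ζ)) :
    ζ * c / (L + 1) ≤ α ∨ ζ ^ 2 * δ ^ 2 ≤ α ^ 2 * ∑ i ∈ inactiveSet x δ, p i ^ 2 := by
  rcases h with h | h
  · refine Or.inl (le_trans ?_ h)
    rw [div_le_one (by positivity)]
    nlinarith
  · contrapose! h
    obtain ⟨h1, h2⟩ := h
    refine lineSearchCriterion_of_small hf hL hlip hx hδ hρ' hp hc hc1 hdesc (by positivity) ?_ ?_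
    · rw [lt_div_iff₀ (by positivity)] at h1
      rw [div_mul_eq_mul_div, div_le_iff₀ hζ]
      linarith
    · rw [div_pow, div_mul_eq_mul_div, div_le_iff₀ (by positivity)]
      linarith

lemma exists_forall_le_lineSearchCriterion {L : ℝ} (hf : Differentiable ℝ f) (hL : 0 ≤ L)
    (hlip : ∀ x ∈ orthant d, ∀ y ∈ orthant d, ‖gradient f x - gradient f y‖ ≤ L * ‖x - y‖)
    (hx : x ∈ orthant d) (hδ : 0 < δ) (hρ' : ρ ≤ 1 / 2)
    (hp : ∀ i ∈ activeSet x δ, p i = -gradient f x i) (hc : 0 < c) (hc1 : c ≤ 1)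
    (hdesc : ∑ i ∈ inactiveSet x δ, gradient f x i * p i ≤
      -(c * ∑ i ∈ inactiveSet x δ, p i ^ 2)) :
    ∃ a > 0, ∀ α, 0 < α → α ≤ a → LineSearchCriterion f δ ρ x p α := by
  have hq : 0 ≤ ∑ i ∈ inactiveSet x δ, p i ^ 2 := Finset.sum_nonneg fun i _ => sq_nonneg _
  refine ⟨min (c / (L + 1)) (min 1 (δ ^ 2 / (∑ i ∈ inactiveSet x δ, p i ^ 2 + 1))), by positivity,
    fun α hα h => lineSearchCriterion_of_small hf hL hlip hx hδ.le hρ' hp hc.le hc1 hdesc hα ?_ ?_⟩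
  · have h1 := h.trans (min_le_left _ _)
    rw [le_div_iff₀ (by positivity)] at h1
    linarith
  · have h1 := (h.trans (min_le_right _ _)).trans (min_le_left _ _)
    have h2 := (h.trans (min_le_right _ _)).trans (min_le_right _ _)
    rw [le_div_iff₀ (by positivity)] at h2
    have h3 : α ^ 2 ≤ α := by nlinarith
    have h4 := mul_le_mul_of_nonneg_right h3 hq
    linarith

/-- Long steps are rejected if `f` is bounded below on the orthant and the direction descends on
the inactive set. -/
lemma exists_forall_lt_not_lineSearchCriterion {fstar : ℝ} (hbdd : ∀ x ∈ orthant d, fstar ≤ f x)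
    (hρ : 0 < ρ) (hp : ∀ i ∈ activeSet x δ, p i = -gradient f x i)
    (hG : ∑ i ∈ inactiveSet x δ, gradient f x i * p i < 0) :
    ∃ b, ∀ α, b < α → ¬ LineSearchCriterion f δ ρ x p α := by
  set G := ∑ i ∈ inactiveSet x δ, gradient f x i * p i
  refine ⟨max 0 ((fstar - f x) / (ρ * G)), fun α hα h => ?_⟩
  have h0 := (le_max_left _ _).trans_lt hα
  have h1 := (le_max_right _ _).trans_lt hα
  rw [div_lt_iff_of_neg (mul_neg_of_pos_of_neg hρ hG)] at h1
  rw [LineSearchCriterion] at h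
  have h2 := hbdd _ (proj_mem_orthant (x + α • p))
  have h3 := mul_nonpos_of_nonneg_of_nonpos hρ.le (sum_activeSet_nonpos hp h0)
  linarith

/-- What MINRES guarantees about the inactive part of the search direction. -/
lemma direction_inactiveSet {L η ς θ : ℝ} {D : StepType} (hf : ContDiff ℝ 2 f) (hL : 0 ≤ L)
    (hlip : ∀ x ∈ orthant d, ∀ y ∈ orthant d, ‖gradient f x - gradient f y‖ ≤ L * ‖x - y‖)
    (hx : x ∈ orthant d) (hδ : 0 ≤ δ) (hη : 0 < η) (hς : 0 < ς) (hθ : θ = (d + 1) * ς)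
    (h : MinresReturns (subHessian f x (inactiveSet x δ))
      (subvec (inactiveSet x δ) (gradient f x)) η θ (subvec (inactiveSet x δ) p) D) :
    ∑ i ∈ inactiveSet x δ, gradient f x i * p i ≤
        -(min 1 ς * ∑ i ∈ inactiveSet x δ, p i ^ 2) ∧
      ‖subvec (inactiveSet x δ) (gradient f x)‖ ≤
        (1 + L / η + (L + η) * L / ς) * ‖subvec (inactiveSet x δ) p‖ ∧
      (D = StepType.npc → ∑ i ∈ inactiveSet x δ, gradient f x i * p i < 0) := by
  have hθ' : (Module.finrank ℝ (EuclideanSpace ℝ (inactiveSet x δ)) + 1) * ς ≤ θ := by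
    have h1 : (inactiveSet x δ).card ≤ d := (Finset.card_le_univ _).trans_eq (Fintype.card_fin d)
    rw [hθ, finrank_euclideanSpace, Fintype.card_coe]
    gcongr
  obtain ⟨h1, h2, h3⟩ := h.direction hη hς hθ' hL (isSymmetric_subHessian hf x _)
    (norm_subHessian_le hf hL hlip hx fun i hi => hδ.trans_lt (by simpa [inactiveSet] using hi))
  rw [inner_subvec, norm_sq_subvec] at h1
  refine ⟨h1, h2, fun hD => h1.trans_lt (neg_neg_of_pos ?_)⟩
  rw [← norm_sq_subvec]
  have := norm_pos_iff.2 (h3 hD)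
  positivity

/-! ### Complexity -/

section Complexity

variable {y : EuclideanSpace ℝ (Fin d)} {P : Params} {k : ℕ} {ε η ς ζ L : ℝ}

/-- The decrease of `f` per iteration, as a multiple of `ε²`. The first term comes from steps cut
short by the bounds on the inactive components, the others from steps of size at least
`ζ min(1, ς) / (L + 1)`: the second if the gradient is large on the inactive set, the third if the
optimality test fails on the active set. -/
noncomputable def decreaseConst (ρ ς η ζ L : ℝ) : ℝ :=
  ρ * min (min 1 ς * ζ ^ 2)
    (min (ζ * min 1 ς / (L + 1) * min 1 ς / (1 + L / η + (L + η) * L / ς) ^ 2)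
      (ζ * min 1 ς / (L + 1)))

lemma decreaseConst_pos (hρ : 0 < ρ) (hς : 0 < ς) (hη : 0 < η) (hζ : 0 < ζ) (hL : 0 ≤ L) :
    0 < decreaseConst ρ ς η ζ L := by
  have h1 : 0 < min 1 ς := by positivity
  have h2 : 0 < 1 + L / η + (L + η) * L / ς := by positivity
  have h3 : 0 < ζ * min 1 ς / (L + 1) := by positivity
  exact mul_pos hρ (lt_min (by positivity) (lt_min (by positivity) h3))

lemma Step.mem_orthant (h : Step f P k x y) : y ∈ orthant d := by
  obtain ⟨-, p, D, α, -, -, -, rfl⟩ := h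
  exact proj_mem_orthant _

lemma Step.decrease (h : Step f P k x y) (hf : ContDiff ℝ 2 f)
    (hlip : ∀ x ∈ orthant d, ∀ y ∈ orthant d, ‖gradient f x - gradient f y‖ ≤ L * ‖x - y‖)
    (hρ : 0 < ρ) (hρ' : ρ < 1 / 2) (hς : 0 < ς) (hη : 0 < η) (hζ : 0 < ζ) (hζ' : ζ < 1)
    (hL : 0 ≤ L) (hε : 0 < ε) (hε1 : ε < 1) (hx : x ∈ orthant d)
    (hP : P = { δ := fun _ => √ε, ε := fun _ => √ε, η := η, θ := (d + 1) * ς, ρ := ρ, ζ := ζ }) :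
    f y ≤ f x - decreaseConst ρ ς η ζ L * ε ^ 2 := by
  obtain ⟨hterm, p, D, α, hp, hmin, hα, rfl⟩ := h
  have hPδ : P.δ k = √ε := by rw [hP]
  have hPρ : P.ρ = ρ := by rw [hP]
  have hPζ : P.ζ = ζ := by rw [hP]
  have hPη : P.η = η := by rw [hP]
  have hPθ : P.θ = (d + 1) * ς := by rw [hP]
  rw [hPδ] at hp hmin hα
  rw [hPη] at hmin
  rw [hPρ, hPζ] at hα
  obtain ⟨hdesc, hnorm, -⟩ :=
    direction_inactiveSet hf hL hlip hx (Real.sqrt_nonneg ε) hη hς hPθ hmin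
  have hspec : 0 < α ∧ LineSearchCriterion f (√ε) ρ x p α ∧
      (1 ≤ α ∨ ¬ LineSearchCriterion f (√ε) ρ x p (α / ζ)) := by
    rcases D with _ | _
    · exact hα.spec hζ
    · exact hα.spec hζ hζ'
  obtain ⟨hα0, hcrit, hmax⟩ := hspec
  have hc : 0 < min 1 ς := by positivity
  have hτ1 : ζ * min 1 ς / (L + 1) ≤ 1 := by
    rw [div_le_one (by positivity)]
    have : min 1 ς ≤ 1 := min_le_left _ _
    nlinarith
  have hlong := le_or_le_of_not_lineSearchCriterion (hf.differentiable (by norm_num)) hL hlip hx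
    (Real.sqrt_nonneg ε) hρ'.le hζ hζ' hp hc.le (min_le_left _ _) hdesc hα0 hmax
  rw [Real.sq_sqrt hε.le] at hlong
  exact decrease_of_lineSearchCriterion hε hε1 hPδ (by rw [hP]) hρ hζ (by positivity) hτ1 hc
    (by positivity) hterm hp hdesc hnorm hα0 hcrit hlong

lemma exists_step {fstar : ℝ} (hf : ContDiff ℝ 2 f)
    (hlip : ∀ x ∈ orthant d, ∀ y ∈ orthant d, ‖gradient f x - gradient f y‖ ≤ L * ‖x - y‖)
    (hbdd : ∀ x ∈ orthant d, fstar ≤ f x)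
    (hρ : 0 < ρ) (hρ' : ρ < 1 / 2) (hς : 0 < ς) (hη : 0 < η) (hζ : 0 < ζ) (hζ' : ζ < 1)
    (hL : 0 ≤ L) (hε : 0 < ε) (hx : x ∈ orthant d)
    (hP : P = { δ := fun _ => √ε, ε := fun _ => √ε, η := η, θ := (d + 1) * ς, ρ := ρ, ζ := ζ })
    (hterm : ¬ Terminates f P k x) : ∃ y, Step f P k x y := by
  have hδ : 0 < √ε := Real.sqrt_pos.2 hε
  obtain ⟨q, D, hmin⟩ := exists_minresReturns (H := subHessian f x (inactiveSet x (√ε)))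
    (θ := (d + 1) * ς) η (by positivity) (isSymmetric_subHessian hf x _)
    (subvec (inactiveSet x (√ε)) (gradient f x))
  set p := glue (inactiveSet x (√ε)) q (-gradient f x) with hpdef
  have hp : ∀ i ∈ activeSet x (√ε), p i = -gradient f x i := fun i hi => by
    have : i ∉ inactiveSet x (√ε) := by
      simpa [inactiveSet] using (apply_of_mem_activeSet hi).2
    simp [hpdef, glue_apply_of_notMem this]
  rw [← subvec_glue (inactiveSet x (√ε)) q (-gradient f x), ← hpdef] at hmin
  obtain ⟨hdesc, -, hneg⟩ := direction_inactiveSet hf hL hlip hx hδ.le hη hς rfl hmin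
  obtain ⟨a, ha, hsmall⟩ := exists_forall_le_lineSearchCriterion
    (hf.differentiable (by norm_num)) hL hlip hx hδ hρ'.le hp (by positivity) (min_le_left _ _)
    hdesc
  subst hP
  rcases D with _ | _
  · obtain ⟨α, hα⟩ := exists_backtrackReturns hζ hζ' ha hsmall
    exact ⟨_, hterm, p, .sol, α, hp, hmin, hα, rfl⟩
  · obtain ⟨α, hα⟩ := exists_forwardTrackReturns hζ hζ' ha hsmall
      (exists_forall_lt_not_lineSearchCriterion hbdd hρ hp (hneg rfl))
    exact ⟨_, hterm, p, .npc, α, hp, hmin, hα, rfl⟩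

lemma Terminates.isFO (hε : 0 ≤ ε) (hδ : P.δ k = √ε) (hPε : P.ε k = √ε)
    (h : Terminates f P k x) : IsFO f ε x := by
  rwa [Terminates, hδ, hPε, Real.sq_sqrt hε] at h

/-- If every run has length at most `B` and continues until the termination test holds, then some
run terminates. -/
lemma exists_isRun_terminates {x₀ : EuclideanSpace ℝ (Fin d)} {B : ℝ}
    (hbound : ∀ x N, IsRun f P x₀ x N → (N : ℝ) ≤ B)
    (hnext : ∀ x N, IsRun f P x₀ x N → ¬ Terminates f P N (x N) → ∃ y, Step f P N (x N) y) :
    ∃ x N, IsRun f P x₀ x N ∧ Terminates f P N (x N) := by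
  by_contra! hnot
  have hall : ∀ N, ∃ x, IsRun f P x₀ x N := by
    intro N
    induction N with
    | zero => exact ⟨fun _ => x₀, rfl, by simp⟩
    | succ N ih =>
      obtain ⟨x, hx⟩ := ih
      obtain ⟨y, hy⟩ := hnext x N hx (hnot x N hx)
      refine ⟨fun j => if j ≤ N then x j else y, by simpa using hx.1, fun k hk => ?_⟩
      rcases (Nat.lt_succ_iff_lt_or_eq.1 hk) with h | rfl
      · simpa [h.le, Nat.succ_le_of_lt h] using hx.2 k h
      · simpa using hy
  obtain ⟨N, hN⟩ := exists_nat_gt B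
  obtain ⟨x, hx⟩ := hall N
  exact (hbound x N hx).not_gt hN

end Complexity

end NewtonMRTMP

/-- Global complexity of the Newton-MR two-metric projection method. The constant `C` depends only
on `ρ, ς, η, ζ, L` (not on the dimension, the objective, the initial point or `ε`). A run that meets
its termination test is at an `ε`-FO point after at most `C (f x₀ - fstar) ε⁻²` iterations; such a
run exists; every run obeys the bound; and the algorithm never gets stuck (MINRES and the line
search return at every iteration). -/
theorem theorem1 (ρ ς η ζ L : ℝ) (hρ : 0 < ρ) (hρ' : ρ < 1 / 2) (hς : 0 < ς) (hη : 0 < η)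
    (hζ : 0 < ζ) (hζ' : ζ < 1) (hL : 0 ≤ L) :
    ∃ C : ℝ, 0 < C ∧
      ∀ (d : ℕ) (f : EuclideanSpace ℝ (Fin d) → ℝ) (fstar : ℝ) (x₀ : EuclideanSpace ℝ (Fin d))
        (ε : ℝ) (P : NewtonMRTMP.Params),
        ContDiff ℝ 2 f →
        (∀ x ∈ NewtonMRTMP.orthant d, ∀ y ∈ NewtonMRTMP.orthant d,
          ‖gradient f x - gradient f y‖ ≤ L * ‖x - y‖) →
        (∀ x ∈ NewtonMRTMP.orthant d, fstar ≤ f x) →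
        x₀ ∈ NewtonMRTMP.orthant d →
        0 < ε → ε < 1 →
        P = { δ := fun _ => √ε, ε := fun _ => √ε, η := η, θ := (d + 1) * ς, ρ := ρ, ζ := ζ } →
        (∃ (x : ℕ → EuclideanSpace ℝ (Fin d)) (N : ℕ),
          NewtonMRTMP.IsRun f P x₀ x N ∧ NewtonMRTMP.Terminates f P N (x N) ∧
          (N : ℝ) ≤ C * (f x₀ - fstar) / ε ^ 2 ∧
          x N ∈ NewtonMRTMP.orthant d ∧ NewtonMRTMP.IsFO f ε (x N)) ∧
        (∀ (x : ℕ → EuclideanSpace ℝ (Fin d)) (N : ℕ), NewtonMRTMP.IsRun f P x₀ x N →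
          (N : ℝ) ≤ C * (f x₀ - fstar) / ε ^ 2 ∧ x N ∈ NewtonMRTMP.orthant d ∧
          ((NewtonMRTMP.Terminates f P N (x N) ∧ NewtonMRTMP.IsFO f ε (x N)) ∨
            ∃ y, NewtonMRTMP.Step f P N (x N) y)) := by
  have hD := NewtonMRTMP.decreaseConst_pos hρ hς hη hζ hL
  refine ⟨1 / NewtonMRTMP.decreaseConst ρ ς η ζ L, by positivity, ?_⟩
  intro d f fstar x₀ ε P hf hlip hbdd hx₀ hε hε1 hP
  have hrun : ∀ (x : ℕ → EuclideanSpace ℝ (Fin d)) (N : ℕ), NewtonMRTMP.IsRun f P x₀ x N →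
      ∀ k ≤ N, x k ∈ NewtonMRTMP.orthant d ∧
        f (x k) ≤ f x₀ - k * (NewtonMRTMP.decreaseConst ρ ς η ζ L * ε ^ 2) := by
    intro x N hx k
    induction k with
    | zero => intro _; simp [hx.1, hx₀]
    | succ k ih =>
      intro hk
      obtain ⟨hmem, hle⟩ := ih (Nat.le_of_succ_le hk)
      have hstep := hx.2 k hk
      have := hstep.decrease hf hlip hρ hρ' hς hη hζ hζ' hL hε hε1 hmem hP
      refine ⟨hstep.mem_orthant, ?_⟩
      push_cast
      linarith
  have hbound : ∀ (x : ℕ → EuclideanSpace ℝ (Fin d)) (N : ℕ), NewtonMRTMP.IsRun f P x₀ x N →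
      (N : ℝ) ≤ 1 / NewtonMRTMP.decreaseConst ρ ς η ζ L * (f x₀ - fstar) / ε ^ 2 := by
    intro x N hx
    obtain ⟨hmem, hle⟩ := hrun x N hx N le_rfl
    have h1 := hbdd _ hmem
    rw [one_div, inv_mul_eq_div, div_div, le_div_iff₀ (by positivity)]
    linarith
  have hmem : ∀ (x : ℕ → EuclideanSpace ℝ (Fin d)) (N : ℕ), NewtonMRTMP.IsRun f P x₀ x N →
      x N ∈ NewtonMRTMP.orthant d := fun x N hx => (hrun x N hx N le_rfl).1
  have hnext : ∀ (x : ℕ → EuclideanSpace ℝ (Fin d)) (N : ℕ), NewtonMRTMP.IsRun f P x₀ x N →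
      ¬ NewtonMRTMP.Terminates f P N (x N) → ∃ y, NewtonMRTMP.Step f P N (x N) y :=
    fun x N hx => NewtonMRTMP.exists_step hf hlip hbdd hρ hρ' hς hη hζ hζ' hL hε (hmem x N hx) hP
  have hFO : ∀ (x : ℕ → EuclideanSpace ℝ (Fin d)) (N : ℕ),
      NewtonMRTMP.Terminates f P N (x N) → NewtonMRTMP.IsFO f ε (x N) :=
    fun x N h => h.isFO hε.le (by rw [hP]) (by rw [hP])
  constructor
  · obtain ⟨x, N, hx, hterm⟩ := NewtonMRTMP.exists_isRun_terminates hbound hnext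
    exact ⟨x, N, hx, hterm, hbound x N hx, hmem x N hx, hFO x N hterm⟩
  · intro x N hx
    refine ⟨hbound x N hx, hmem x N hx, ?_⟩
    by_cases hterm : NewtonMRTMP.Terminates f P N (x N)
    · exact Or.inl ⟨hterm, hFO x N hterm⟩
    · exact Or.inr (hnext x N hx hterm)
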